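/- For ordinals $\alpha,\beta$ let $\alpha\#\beta$ denote the (Hessenberg) natural sum, obtained by adding the coefficients of equal powers of $\omega$ in the Cantor normal forms. Given a sequence of ordinals $(\alpha_\gamma)_{\gamma<\zeta}$, the iterated natural sum $\sum^{\#}_{\gamma<\delta}\alpha_\gamma$ ($\delta\le\zeta$) is defined by recursion: $\sum^{\#}_{\gamma<0}\alpha_\gamma=0$; $\sum^{\#}_{\gamma<\delta+1}\alpha_\gamma=\bigl(\sum^{\#}_{\gamma<\delta}\alpha_\gamma\bigr)\#\alpha_\delta$; and $\sum^{\#}_{\gamma<\delta}\alpha_\gamma=\sup_{\delta'<\delta}\sum^{\#}_{\gamma<\delta'}\alpha_\gamma$ for $\delta$ limit. The components of $\zeta$ are the sets $[\alpha,\alpha+\omega)\cap\zeta$, where $\alpha<\zeta$ is either $0$ or a limit ordinal; they partition $\zeta$. **Proposition.** Let $(\alpha_\gamma)_{\gamma<\zeta}$ be a sequence of ordinals. (1) If $\pi$ is a permutation of $\zeta$ such that $\pi(C)=C$ for every component $C$ of $\zeta$, then $$\sum^{\#}_{\gamma<\zeta}\alpha_\gamma=\sum^{\#}_{\gamma<\zeta}\alpha_{\pi(\gamma)}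 .$$ (2) More generally, let $(F_h)_{h<\zeta'}$ be a sequence, indexed by an ordinal $\zeta'$, of pairwise disjoint (possibly empty) sets with union $\zeta$ such that (a) each $F_h$ is finite; (b) each $F_h$ is a subset of some component $C_h$ of $\zeta$; (c) whenever $C_h$ occurs before $C_{h'}$ in $\zeta$, then $h<h'$; moreover, for each component $C$, the set $\{h<\zeta' : C_h=C\}$ has order type at most $\omega$ (apart from this, the ordering of the $F_h$'s inside a component is arbitrary). Then $$\sum^{\#}_{\gamma<\zeta}\alpha_\gamma=\sum^{\#}_{h<\zeta'}\ \mathop{\#}_{\delta\in F_h}\alpha_\delta ,$$ where $\mathop{\#}_{\delta\in F_h}\alpha_\delta$ is the natural sum of the finitely many ordinals $\alpha_\delta$, $\delta\in F_h$ (and is $0$ if $F_h=\emptyset$). -/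

import Mathlib

universe u

namespace IterNatSum

open Ordinal

/-- The (Hessenberg) natural sum of two ordinals: add the coefficients of equal powers of `ω` in
the Cantor normal forms. -/
noncomputable def natAdd (a b : Ordinal.{u}) : Ordinal.{u} :=
  CNF.eval omega0 (CNF.coeff omega0 a + CNF.coeff omega0 b)

theorem coeff_lt_omega0 (a e : Ordinal.{u}) : CNF.coeff omega0 a e < omega0 := by
  by_cases h : e ∈ (CNF omega0 a).map Prod.fst
  · rw [List.mem_map] at h
    obtain ⟨⟨e', c⟩, hc, rfl⟩ := h
    rw [CNF.coeff_of_mem_CNF hc]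
    exact CNF.snd_lt one_lt_omega0 hc
  · rw [CNF.coeff_of_notMem_CNF h]
    exact omega0_pos

theorem coeff_natAdd (a b : Ordinal.{u}) :
    CNF.coeff omega0 (natAdd a b) = CNF.coeff omega0 a + CNF.coeff omega0 b := by
  apply CNF.coeff_eval one_lt_omega0
  intro e
  obtain ⟨m, hm⟩ := lt_omega0.1 (coeff_lt_omega0 a e)
  obtain ⟨n, hn⟩ := lt_omega0.1 (coeff_lt_omega0 b e)
  rw [Finsupp.add_apply, hm, hn, ← Nat.cast_add]
  exact natCast_lt_omega0 _

theorem natAdd_comm (a b : Ordinal.{u}) : natAdd a b = natAdd b a := by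
  apply CNF.coeff_injective omega0
  ext e
  obtain ⟨m, hm⟩ := lt_omega0.1 (coeff_lt_omega0 a e)
  obtain ⟨n, hn⟩ := lt_omega0.1 (coeff_lt_omega0 b e)
  simp only [coeff_natAdd, Finsupp.add_apply, hm, hn, ← Nat.cast_add, Nat.add_comm]

theorem natAdd_assoc (a b c : Ordinal.{u}) :
    natAdd (natAdd a b) c = natAdd a (natAdd b c) := by
  apply CNF.coeff_injective omega0
  simp only [coeff_natAdd]
  ext e
  simp only [Finsupp.add_apply, add_assoc]

instance natAdd_commutative : Std.Commutative natAdd.{u} := ⟨natAdd_comm⟩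

instance natAdd_associative : Std.Associative natAdd.{u} := ⟨natAdd_assoc⟩

/-- The natural sum of the ordinals `α δ`, for `δ` in a finite set `F` (equal to `0` for the empty
set); the order of the summands is irrelevant as `natAdd` is commutative and associative. -/
noncomputable def finNatSum (F : Finset Ordinal.{u}) (α : Ordinal.{u} → Ordinal.{u}) :
    Ordinal.{u} :=
  F.fold natAdd 0 α

/-- The iterated natural sum of `α γ` for `γ < δ`: natural sums at successor steps, suprema at
limit steps. The values `α γ` for `γ ≥ δ` play no role. -/
noncomputable def iterNatSum (α : Ordinal.{u} → Ordinal.{u}) (δ : Ordinal.{u}) : Ordinal.{u} :=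
  limitRecOn δ 0 (fun γ s ↦ natAdd s (α γ)) (fun δ _ s ↦ ⨆ x : Set.Iio δ, s x.1 x.2)

theorem iterNatSum_zero (α : Ordinal.{u} → Ordinal.{u}) : iterNatSum α 0 = 0 :=
  limitRecOn_zero ..

theorem iterNatSum_add_one (α : Ordinal.{u} → Ordinal.{u}) (δ : Ordinal.{u}) :
    iterNatSum α (δ + 1) = natAdd (iterNatSum α δ) (α δ) :=
  limitRecOn_add_one ..

/-- At limits the supremum is a true least upper bound. -/
theorem isLUB_iterNatSum (α : Ordinal.{u} → Ordinal.{u}) {δ : Ordinal.{u}}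
    (hδ : Order.IsSuccLimit δ) : IsLUB (iterNatSum α '' Set.Iio δ) (iterNatSum α δ) := by
  have h : iterNatSum α δ = ⨆ x : Set.Iio δ, iterNatSum α x.1 := limitRecOn_limit _ _ _ _ hδ
  rw [h, Set.image_eq_range]
  have : Nonempty (Set.Iio δ) := ⟨⟨0, hδ.bot_lt⟩⟩
  exact isLUB_ciSup bddAbove_of_small

/-- The components of an ordinal `ζ`: the sets `[a, a + ω) ∩ ζ` for `a < ζ` either zero or limit.
That is, the blocks `[a, a + ω)` with `a + ω ≤ ζ`, and the final segment `[a, ζ)` with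
`ζ ≤ a + ω`. -/
def IsComponent (ζ : Ordinal.{u}) (C : Set Ordinal.{u}) : Prop :=
  ∃ a < ζ, (a = 0 ∨ Order.IsSuccLimit a) ∧ C = Set.Ico a (min (a + omega0) ζ)

/-- `C` occurs before `C'`. -/
def Precedes (C C' : Set Ordinal.{u}) : Prop :=
  ∀ x ∈ C, ∀ y ∈ C', x < y

end IterNatSum

namespace IterNatSum

open Ordinal

/-! Along a segment `[a, b)` of length at most `ω`, the iterated sum is the partial sum at `a` plus,
in the supremum, the natural sums over finite subsets of `[a, b)` (`iterNatSum_le_iff`). This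
description ignores order and grouping, so rearranging inside one block `[a, a + ω)` changes
nothing.

It remains to see that a regrouping keeps blocks aligned: the indices `h` whose `F h` lies in the
block at `a` are exactly those in `[a, a + ω) ∩ ζ'` (`lt_add_omega0_of_finite`, `le_of_regrouping`).
Induction over multiples of `ω` then equates the partial sums; a permutation is a regrouping into
singletons. -/

/-! ### Monotonicity and finite natural sums -/

/-- Evaluation of Cantor normal forms is monotone in the coefficients. -/
theorem eval_mono (b : Ordinal.{u}) {f g : Ordinal.{u} →₀ Ordinal.{u}} (h : ∀ e, f e ≤ g e) :
    CNF.eval b f ≤ CNF.eval b g := by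
  induction g using Finsupp.induction_on_max generalizing f with
  | zero =>
    have : f = 0 := by
      ext e
      simpa using h e
    simp [this]
  | single_add e y g hg hy ih =>
    have hge : g e = 0 := by
      rw [← Finsupp.notMem_support_iff]
      exact fun he ↦ (hg e he).false
    have hf : ∀ e' ∈ (f.erase e).support, e' < e := by
      intro e' he'
      rw [Finsupp.support_erase, Finset.mem_erase] at he'
      refine hg e' (Finsupp.mem_support_iff.2 fun h0 ↦ Finsupp.mem_support_iff.1 he'.2 ?_)
      simpa [Finsupp.single_eq_of_ne he'.1, h0] using h e'
    -- The coefficient of `f` at `e` may be zero; splitting it off anyway gives both sides the same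
    -- leading exponent.
    rw [← Finsupp.single_add_erase e f, CNF.eval_single_add' b hf, CNF.eval_single_add' b hg]
    refine add_le_add (mul_le_mul_right (by simpa [hge] using h e) _) (ih fun e' ↦ ?_)
    by_cases he : e' = e
    · simp [he]
    · simpa [Finsupp.erase_ne he, Finsupp.single_eq_of_ne he] using h e'

theorem le_natAdd (a b : Ordinal.{u}) : a ≤ natAdd a b := by
  conv_lhs => rw [← CNF.eval_coeff omega0 a]
  exact eval_mono _ fun e ↦ by simp

theorem natAdd_zero (a : Ordinal.{u}) : natAdd a 0 = a := by
  apply CNF.coeff_injective omega0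
  rw [coeff_natAdd, CNF.coeff_zero_right, add_zero]

theorem finNatSum_disjUnion (α : Ordinal.{u} → Ordinal.{u}) {s t : Finset Ordinal.{u}}
    (h : Disjoint s t) :
    finNatSum (s.disjUnion t h) α = natAdd (finNatSum s α) (finNatSum t α) := by
  simpa only [natAdd_zero, finNatSum] using
    Finset.fold_disjUnion (op := natAdd) (f := α) (b₁ := 0) (b₂ := 0) h

theorem finNatSum_insert (α : Ordinal.{u} → Ordinal.{u}) {s : Finset Ordinal.{u}} {x : Ordinal.{u}}
    (h : x ∉ s) : finNatSum (insert x s) α = natAdd (α x) (finNatSum s α) :=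
  Finset.fold_insert h

theorem finNatSum_singleton (α : Ordinal.{u} → Ordinal.{u}) (x : Ordinal.{u}) :
    finNatSum {x} α = α x := by
  rw [finNatSum, Finset.fold_singleton, natAdd_zero]

theorem finNatSum_biUnion (α : Ordinal.{u} → Ordinal.{u}) (F : Ordinal.{u} → Finset Ordinal.{u})
    (T : Finset Ordinal.{u}) (hT : (T : Set Ordinal.{u}).PairwiseDisjoint F) :
    finNatSum T (fun h ↦ finNatSum (F h) α) = finNatSum (T.biUnion F) α := by
  induction T using Finset.induction_on with
  | empty => rfl
  | insert x T hx ih =>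
    have hd : Disjoint (F x) (T.biUnion F) := by
      rw [Finset.disjoint_biUnion_right]
      intro y hy
      exact hT (by simp) (by simp [hy]) (by rintro rfl; exact hx hy)
    rw [finNatSum_insert _ hx, ih (hT.subset (by simp)), ← finNatSum_disjUnion _ hd,
      Finset.biUnion_insert, Finset.disjUnion_eq_union]

theorem natAdd_finNatSum_mono (α : Ordinal.{u} → Ordinal.{u}) (a : Ordinal.{u})
    {s t : Finset Ordinal.{u}} (h : s ⊆ t) :
    natAdd a (finNatSum s α) ≤ natAdd a (finNatSum t α) := by
  have hd : Disjoint s (t \ s) := Finset.disjoint_sdiff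
  have ht : t = s.disjUnion (t \ s) hd := by
    rw [Finset.disjUnion_eq_union, Finset.union_sdiff_of_subset h]
  rw [ht, finNatSum_disjUnion, ← natAdd_assoc]
  exact le_natAdd _ _

theorem iterNatSum_mono (α : Ordinal.{u} → Ordinal.{u}) : Monotone (iterNatSum α) := by
  intro x y
  induction y using Ordinal.limitRecOn with
  | zero =>
    intro h
    rw [nonpos_iff_eq_zero.1 h]
  | add_one y ih =>
    intro h
    obtain rfl | h := h.eq_or_lt
    · rfl
    · rw [iterNatSum_add_one]
      exact (ih (Order.lt_add_one_iff.1 h)).trans (le_natAdd _ _)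
  | limit y hy _ =>
    intro h
    obtain rfl | h := h.eq_or_lt
    · rfl
    · exact (isLUB_iterNatSum α hy).1 ⟨x, h, rfl⟩

/-! ### Segments of length at most `ω` -/

/-- The finite interval `[a, a + n)` of ordinals. -/
noncomputable def finIco (a : Ordinal.{u}) (n : ℕ) : Finset Ordinal.{u} :=
  (Finset.range n).image fun i : ℕ ↦ a + (i : Ordinal.{u})

theorem mem_finIco {a x : Ordinal.{u}} {n : ℕ} : x ∈ finIco a n ↔ a ≤ x ∧ x < a + n := by
  simp only [finIco, Finset.mem_image, Finset.mem_range]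
  constructor
  · rintro ⟨i, hi, rfl⟩
    exact ⟨le_self_add, by gcongr⟩
  · rintro ⟨h, h'⟩
    rw [← Ordinal.add_sub_cancel_of_le h, add_lt_add_iff_left] at h'
    obtain ⟨i, hi⟩ := lt_omega0.1 (h'.trans (natCast_lt_omega0 n))
    rw [hi] at h'
    exact ⟨i, by exact_mod_cast h', by rw [← hi, Ordinal.add_sub_cancel_of_le h]⟩

theorem iterNatSum_add_nat (α : Ordinal.{u} → Ordinal.{u}) (a : Ordinal.{u}) (n : ℕ) :
    iterNatSum α (a + n) = natAdd (iterNatSum α a) (finNatSum (finIco a n) α) := by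
  induction n with
  | zero => simp [finIco, finNatSum, natAdd_zero]
  | succ n ih =>
    have : finIco a (n + 1) = insert (a + (n : Ordinal.{u})) (finIco a n) := by
      simp [finIco, Finset.range_add_one]
    rw [this, finNatSum_insert _ (by simp [mem_finIco]), natAdd_comm (α _), ← natAdd_assoc, ← ih,
      Nat.cast_add_one, ← add_assoc, iterNatSum_add_one]

/-- Since `[a, b)` has length at most `ω`, its finite initial segments are cofinal among its finite
subsets. -/
theorem exists_subset_finIco {a b : Ordinal.{u}} (T : Finset Ordinal.{u}) (hab : a ≤ b)
    (hb : b ≤ a + omega0) (hT : ∀ t ∈ T, a ≤ t ∧ t < b) :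
    ∃ n : ℕ, a + n ≤ b ∧ T ⊆ finIco a n := by
  induction T using Finset.induction_on with
  | empty => exact ⟨0, by simpa using hab, by simp⟩
  | insert x T _ ih =>
    obtain ⟨n, hn, hTn⟩ := ih fun t ht ↦ hT t (Finset.mem_insert_of_mem ht)
    obtain ⟨hax, hxb⟩ := hT x (Finset.mem_insert_self x T)
    have hlt := hxb.trans_le hb
    rw [← Ordinal.add_sub_cancel_of_le hax, add_lt_add_iff_left] at hlt
    obtain ⟨i, hi⟩ := lt_omega0.1 hlt
    have hx : x = a + i := by rw [← hi, Ordinal.add_sub_cancel_of_le hax]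
    refine ⟨max n (i + 1), ?_, ?_⟩
    · rcases max_choice n (i + 1) with h | h <;> rw [h]
      · exact hn
      · rw [Nat.cast_add_one, ← add_assoc, ← hx]
        exact Order.add_one_le_of_lt hxb
    · rw [Finset.insert_subset_iff]
      constructor
      · rw [mem_finIco, hx]
        refine ⟨le_self_add, ?_⟩
        gcongr
        simp
      · intro t ht
        obtain ⟨h1, h2⟩ := mem_finIco.1 (hTn ht)
        refine mem_finIco.2 ⟨h1, h2.trans_le ?_⟩
        gcongr
        simp

/-- Along a segment of length at most `ω`, the iterated natural sum is the least upper bound of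
the natural sums over the finite subsets of the segment. -/
theorem iterNatSum_le_iff (α : Ordinal.{u} → Ordinal.{u}) {a b x : Ordinal.{u}} (hab : a ≤ b)
    (hb : b ≤ a + omega0) :
    iterNatSum α b ≤ x ↔ ∀ T : Finset Ordinal.{u}, (∀ t ∈ T, a ≤ t ∧ t < b) →
      natAdd (iterNatSum α a) (finNatSum T α) ≤ x := by
  constructor
  · intro h T hT
    obtain ⟨n, hn, hTn⟩ := exists_subset_finIco T hab hb hT
    refine (natAdd_finNatSum_mono α _ hTn).trans ?_
    rw [← iterNatSum_add_nat]
    exact (iterNatSum_mono α hn).trans h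
  · intro h
    have key : ∀ n : ℕ, a + n ≤ b → iterNatSum α (a + n) ≤ x := fun n hn ↦ by
      rw [iterNatSum_add_nat]
      exact h _ fun t ht ↦ ⟨(mem_finIco.1 ht).1, (mem_finIco.1 ht).2.trans_le hn⟩
    -- Either `b = a + ω` is a limit, with the points `a + n` cofinal in it, or `b` is itself some
    -- `a + n`.
    obtain rfl | hlt := hb.eq_or_lt
    · refine (isLUB_le_iff (isLUB_iterNatSum α
        (isSuccLimit_add a isSuccLimit_omega0))).2 ?_
      rintro _ ⟨c, hc, rfl⟩
      obtain ⟨d, hd, hcd⟩ := (lt_add_iff omega0_ne_zero).1 hc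
      obtain ⟨n, rfl⟩ := lt_omega0.1 hd
      exact (iterNatSum_mono α hcd).trans (key n (by gcongr))
    · rw [← Ordinal.add_sub_cancel_of_le hab, add_lt_add_iff_left] at hlt
      obtain ⟨n, hn⟩ := lt_omega0.1 hlt
      have hbn : b = a + n := by rw [← hn, Ordinal.add_sub_cancel_of_le hab]
      rw [hbn]
      exact key n hbn.ge

/-! ### Blocks `[a, a + ω)` with `ω ∣ a` -/

theorem eq_zero_or_isSuccLimit_iff {a : Ordinal.{u}} :
    (a = 0 ∨ Order.IsSuccLimit a) ↔ omega0 ∣ a := by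
  rw [isSuccLimit_iff, isSuccPrelimit_iff_omega0_dvd]
  constructor
  · rintro (rfl | h)
    · exact dvd_zero _
    · exact h.2
  · intro h
    by_cases h0 : a = 0
    · exact .inl h0
    · exact .inr ⟨h0, h⟩

theorem add_omega0_le_of_lt {a b : Ordinal.{u}} (ha : omega0 ∣ a) (hb : omega0 ∣ b)
    (h : a < b) : a + omega0 ≤ b := by
  obtain ⟨i, rfl⟩ := ha
  obtain ⟨j, rfl⟩ := hb
  rw [← mul_add_one]
  have hij : i < j := lt_of_mul_lt_mul_left h zero_le
  exact mul_le_mul_right (Order.add_one_le_of_lt hij) _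

theorem eq_of_mem_block {a b x : Ordinal.{u}} (ha : omega0 ∣ a) (hb : omega0 ∣ b)
    (hax : a ≤ x) (hxa : x < a + omega0) (hbx : b ≤ x) (hxb : x < b + omega0) : a = b := by
  rcases lt_trichotomy a b with h | h | h
  · exact absurd ((add_omega0_le_of_lt ha hb h).trans hbx) hxa.not_ge
  · exact h
  · exact absurd ((add_omega0_le_of_lt hb ha h).trans hax) hxb.not_ge

theorem exists_block (x : Ordinal.{u}) :
    ∃ a, omega0 ∣ a ∧ a ≤ x ∧ x < a + omega0 := by
  refine ⟨omega0 * (x / omega0), dvd_mul_right _ _, mul_div_le _ _, ?_⟩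
  conv_lhs => rw [← div_add_mod x omega0]
  gcongr
  exact mod_lt _ omega0_ne_zero

theorem infinite_block (a : Ordinal.{u}) : (Set.Ico a (a + omega0)).Infinite := by
  refine Set.infinite_of_injective_forall_mem (f := fun n : ℕ ↦ a + n) ?_ fun n ↦
    ⟨le_self_add, by gcongr; exact natCast_lt_omega0 n⟩
  intro m n h
  simpa using h

theorem finite_Ico_of_lt_add_omega0 {a x : Ordinal.{u}} (h : x < a + omega0) :
    (Set.Ico a x).Finite := by
  obtain ⟨d, hd, hcd⟩ := (lt_add_iff omega0_ne_zero).1 h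
  obtain ⟨n, rfl⟩ := lt_omega0.1 hd
  exact (finIco a n).finite_toSet.subset fun y hy ↦ mem_finIco.2 ⟨hy.1, hy.2.trans_le hcd⟩

/-! ### Alignment of blocks and the regrouping law -/

section Regrouping

variable {ζ ζ' : Ordinal.{u}} {F : Ordinal.{u} → Finset Ordinal.{u}} {c : Ordinal.{u} → Ordinal.{u}}

/-- An index lies before the end of the block containing its finite set. -/
theorem lt_add_omega0_of_finite (hmono : ∀ h < ζ', ∀ h' < ζ', c h < c h' → h < h')
    (hdvd : ∀ h < ζ', omega0 ∣ c h) (hfin : ∀ h < ζ', {k | k < h ∧ c k = c h}.Finite) :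
    ∀ h < ζ', h < c h + omega0 := by
  intro h
  induction h using WellFoundedLT.induction with
  | ind h ih =>
  intro hh
  by_contra! hle
  have hlim := isSuccLimit_add (c h) isSuccLimit_omega0
  -- Otherwise every `k` in the block at `c h` is below `h`, so `c k ≤ c h`; and `c k < c h` would
  -- give `k < c k + ω ≤ c h` by induction. Infinitely many earlier indices would share the block of
  -- `h`.
  refine infinite_block (c h) ((hfin h hh).subset fun k hk ↦ ?_)
  have hkh : k < h := hk.2.trans_le hle
  have hk' := hkh.trans hh
  refine ⟨hkh, (not_lt.1 fun hlt ↦ (hmono h hh k hk' hlt).not_gt hkh).antisymm ?_⟩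
  by_contra! hlt
  exact ((ih k hkh hk').trans_le (add_omega0_le_of_lt (hdvd k hk') (hdvd h hh) hlt)).not_ge hk.1

/-- If `x < a + ω`, the finitely many finite sets `F h` with `h ∈ [a, x)` would cover an infinite
block. -/
theorem add_omega0_le_of_forall_lt (hF : ∀ δ < ζ, ∃ h < ζ', δ ∈ F h)
    (hdvd : ∀ h < ζ', omega0 ∣ c h) (hFc : ∀ h < ζ', ∀ δ ∈ F h, c h ≤ δ ∧ δ < c h + omega0)
    {a x : Ordinal.{u}} (ha : omega0 ∣ a) (haζ : a + omega0 ≤ ζ)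
    (hax : ∀ h < ζ', c h = a → a ≤ h ∧ h < x) : a + omega0 ≤ x := by
  by_contra! hlt
  refine infinite_block a (((finite_Ico_of_lt_add_omega0 hlt).biUnion
    fun h _ ↦ (F h).finite_toSet).subset fun δ hδ ↦ ?_)
  obtain ⟨h, hh, hδh⟩ := hF δ (hδ.2.trans_le haζ)
  obtain ⟨h1, h2⟩ := hFc h hh δ hδh
  exact Set.mem_biUnion (hax h hh (eq_of_mem_block (hdvd h hh) ha h1 h2 hδ.1 hδ.2)) hδh

/-- An index lies after the beginning of the block containing its finite set. -/
theorem le_of_regrouping (hF : ∀ δ < ζ, ∃ h < ζ', δ ∈ F h)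
    (hmono : ∀ h < ζ', ∀ h' < ζ', c h < c h' → h < h')
    (hdvd : ∀ h < ζ', omega0 ∣ c h) (hFc : ∀ h < ζ', ∀ δ ∈ F h, c h ≤ δ ∧ δ < c h + omega0)
    (hcζ : ∀ h < ζ', c h < ζ) (h : Ordinal.{u}) (hh : h < ζ') : c h ≤ h := by
  have key : ∀ a, ∀ h < ζ', c h = a → a ≤ h := by
    intro a
    induction a using WellFoundedLT.induction with
    | ind a ih =>
    rintro h hh rfl
    refine le_of_forall_lt fun y hy ↦ ?_
    obtain ⟨a, ha, hay, hya⟩ := exists_block y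
    have hac : a < c h := hay.trans_lt hy
    -- The block of `y` lies wholly below `ζ`; its indices are at least `a` by induction and below
    -- `h` by monotonicity, which forces `a + ω ≤ h`.
    refine hya.trans_le (add_omega0_le_of_forall_lt hF hdvd hFc ha
      ((add_omega0_le_of_lt ha (hdvd h hh) hac).trans (hcζ h hh).le) fun k hk hka ↦
      ⟨ih a hac k hk hka, hmono k hk h hh (hka ▸ hac)⟩)
  exact key _ h hh rfl

/-- The generalized associative-commutative law, with components given by their least elements. -/
theorem iterNatSum_regroup (α : Ordinal.{u} → Ordinal.{u})
    (hF : ∀ δ, δ < ζ ↔ ∃ h < ζ', δ ∈ F h) (hdisj : (Set.Iio ζ').PairwiseDisjoint F)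
    (hmono : ∀ h < ζ', ∀ h' < ζ', c h < c h' → h < h')
    (hdvd : ∀ h < ζ', omega0 ∣ c h) (hFc : ∀ h < ζ', ∀ δ ∈ F h, c h ≤ δ ∧ δ < c h + omega0)
    (hcζ : ∀ h < ζ', c h < ζ) (hfin : ∀ h < ζ', {k | k < h ∧ c k = c h}.Finite) :
    iterNatSum α ζ = iterNatSum (fun h ↦ finNatSum (F h) α) ζ' := by
  have hF' : ∀ δ < ζ, ∃ h < ζ', δ ∈ F h := fun δ ↦ (hF δ).1
  have hup := lt_add_omega0_of_finite hmono hdvd hfin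
  have hlow := le_of_regrouping hF' hmono hdvd hFc hcζ
  have hlen : ∀ a, omega0 ∣ a → a + omega0 ≤ ζ → a + omega0 ≤ ζ' := fun a ha haζ ↦
    add_omega0_le_of_forall_lt hF' hdvd hFc ha haζ fun h hh hha ↦ ⟨hha ▸ hlow h hh, hh⟩
  have hlen' : ∀ a, omega0 ∣ a → a ≤ ζ → a ≤ ζ' := by
    intro a ha haζ
    refine le_of_forall_lt fun y hy ↦ ?_
    obtain ⟨b, hb, hby, hyb⟩ := exists_block y
    exact hyb.trans_le (hlen b hb
      ((add_omega0_le_of_lt hb ha (hby.trans_lt hy)).trans haζ))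
  set β := fun h ↦ finNatSum (F h) α with hβ
  have step : ∀ a, omega0 ∣ a → a ≤ ζ → iterNatSum α a = iterNatSum β a →
      iterNatSum α (min (a + omega0) ζ) = iterNatSum β (min (a + omega0) ζ') := by
    intro a ha haζ heq
    -- Both sides are suprema over finite sets, so it suffices to compare upper bounds.
    refine eq_of_forall_ge_iff fun x ↦ ?_
    rw [iterNatSum_le_iff α (le_min le_self_add haζ) (min_le_left _ _),
      iterNatSum_le_iff β (le_min le_self_add (hlen' a ha haζ)) (min_le_left _ _), heq]
    constructor
    · intro H T hT
      rw [hβ, finNatSum_biUnion _ _ _ fun s hs t ht hst ↦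
        hdisj ((hT s hs).2.trans_le (min_le_right _ _))
          ((hT t ht).2.trans_le (min_le_right _ _)) hst]
      refine H _ fun δ hδ ↦ ?_
      obtain ⟨h, hhT, hδh⟩ := Finset.mem_biUnion.1 hδ
      obtain ⟨hah, hhm⟩ := hT h hhT
      obtain ⟨hha, hh⟩ := lt_min_iff.1 hhm
      have hc : c h = a := eq_of_mem_block (hdvd h hh) ha (hlow h hh) (hup h hh) hah hha
      obtain ⟨h1, h2⟩ := hFc h hh δ hδh
      rw [hc] at h1 h2
      exact ⟨h1, lt_min h2 ((hF δ).2 ⟨h, hh, hδh⟩)⟩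
    · intro H T hT
      choose! g hg hgF using hF'
      have hTζ : ∀ t ∈ T, t < ζ := fun t ht ↦ (hT t ht).2.trans_le (min_le_right _ _)
      have hT' : ∀ h ∈ T.image g, a ≤ h ∧ h < min (a + omega0) ζ' := by
        intro h hh
        obtain ⟨t, ht, rfl⟩ := Finset.mem_image.1 hh
        have hgt := hg t (hTζ t ht)
        obtain ⟨h1, h2⟩ := hFc _ hgt t (hgF t (hTζ t ht))
        have hc : c (g t) = a := eq_of_mem_block (hdvd _ hgt) ha h1 h2 (hT t ht).1
          ((hT t ht).2.trans_le (min_le_left _ _))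
        exact ⟨hc ▸ hlow _ hgt, lt_min (hc ▸ hup _ hgt) hgt⟩
      have := H _ hT'
      rw [hβ, finNatSum_biUnion _ _ _ fun s hs t ht hst ↦
        hdisj ((hT' s hs).2.trans_le (min_le_right _ _))
          ((hT' t ht).2.trans_le (min_le_right _ _)) hst] at this
      -- The sets `F (g t)` cover `T` but may be larger, so only an inequality is available, and it
      -- is enough.
      exact (natAdd_finNatSum_mono α _ fun t ht ↦ Finset.mem_biUnion.2
        ⟨g t, Finset.mem_image_of_mem g ht, hgF t (hTζ t ht)⟩).trans this
  have main : ∀ a, omega0 ∣ a → a ≤ ζ → iterNatSum α a = iterNatSum β a := by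
    intro a
    induction a using WellFoundedLT.induction with
    | ind a ih =>
    intro ha haζ
    -- Block ends are cofinal up to `a`, whether `a` ends a block or is a limit of blocks, so
    -- agreement there equates the suprema.
    have hblock : ∀ y < a, ∃ b, y ≤ b ∧ b ≤ a ∧ iterNatSum α b = iterNatSum β b := by
      intro y hy
      obtain ⟨b, hb, hby, hyb⟩ := exists_block y
      have hba := hby.trans_lt hy
      have hle := add_omega0_le_of_lt hb ha hba
      refine ⟨b + omega0, hyb.le, hle, ?_⟩
      have := step b hb (hba.le.trans haζ) (ih b hba hb (hba.le.trans haζ))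
      rwa [min_eq_left (hle.trans haζ), min_eq_left (hlen b hb (hle.trans haζ))] at this
    rcases eq_zero_or_isSuccLimit_iff.2 ha with rfl | hlim
    · rw [iterNatSum_zero, iterNatSum_zero]
    · apply le_antisymm
      · refine (isLUB_le_iff (isLUB_iterNatSum α hlim)).2 ?_
        rintro _ ⟨y, hy, rfl⟩
        obtain ⟨b, hyb, hba, h⟩ := hblock y hy
        exact (iterNatSum_mono α hyb).trans (h.le.trans (iterNatSum_mono β hba))
      · refine (isLUB_le_iff (isLUB_iterNatSum β hlim)).2 ?_
        rintro _ ⟨y, hy, rfl⟩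
        obtain ⟨b, hyb, hba, h⟩ := hblock y hy
        exact (iterNatSum_mono β hyb).trans (h.ge.trans (iterNatSum_mono α hba))
  -- The last block is truncated, possibly empty (`a = ζ`); no index goes beyond it.
  obtain ⟨a, ha, haζ, hζa⟩ := exists_block ζ
  have hle : ζ' ≤ a + omega0 := by
    refine le_of_forall_lt fun h hh ↦ (hup h hh).trans_le ?_
    gcongr
    by_contra! hlt
    exact ((add_omega0_le_of_lt ha (hdvd h hh) hlt).trans (hcζ h hh).le).not_gt hζa
  have := step a ha haζ (main a ha haζ)
  rwa [min_eq_right hζa.le, min_eq_right hle] at this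

end Regrouping

/-! ### Both statements in terms of components -/

theorem iterNatSum_regroup_of_isComponent {ζ ζ' : Ordinal.{u}} (α : Ordinal.{u} → Ordinal.{u})
    (F : Ordinal.{u} → Finset Ordinal.{u}) (C : Ordinal.{u} → Set Ordinal.{u})
    (hF : ∀ δ, δ < ζ ↔ ∃ h < ζ', δ ∈ F h) (hdisj : (Set.Iio ζ').PairwiseDisjoint F)
    (hC : ∀ h < ζ', IsComponent ζ (C h)) (hFC : ∀ h < ζ', (F h : Set Ordinal.{u}) ⊆ C h)
    (hprec : ∀ h < ζ', ∀ h' < ζ', Precedes (C h) (C h') → h < h')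
    (hfin : ∀ h < ζ', {k | k < h ∧ C k = C h}.Finite) :
    iterNatSum α ζ = iterNatSum (fun h ↦ finNatSum (F h) α) ζ' := by
  choose! c hcζ hlim hCc using hC
  have hdvd : ∀ h < ζ', omega0 ∣ c h := fun h hh ↦ eq_zero_or_isSuccLimit_iff.1 (hlim h hh)
  refine iterNatSum_regroup (c := c) α hF hdisj ?_ hdvd ?_ hcζ ?_
  · intro h hh h' hh' hlt
    refine hprec h hh h' hh' fun x hx y hy ↦ ?_
    rw [hCc h hh] at hx
    rw [hCc h' hh'] at hy
    exact (hx.2.trans_le (min_le_left _ _)).trans_le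
      ((add_omega0_le_of_lt (hdvd h hh) (hdvd h' hh') hlt).trans hy.1)
  · intro h hh δ hδ
    have := hFC h hh hδ
    rw [hCc h hh] at this
    exact ⟨this.1, this.2.trans_le (min_le_left _ _)⟩
  · intro h hh
    refine (hfin h hh).subset fun k hk ↦ ⟨hk.1, ?_⟩
    rw [hCc k (hk.1.trans hh), hCc h hh, hk.2]

theorem iterNatSum_perm {ζ : Ordinal.{u}} (α π : Ordinal.{u} → Ordinal.{u})
    (hπ : Set.BijOn π (Set.Iio ζ) (Set.Iio ζ)) (hπC : ∀ C, IsComponent ζ C → π '' C = C) :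
    iterNatSum α ζ = iterNatSum (fun γ ↦ α (π γ)) ζ := by
  -- Here `c h` is the start of the block containing `h`, which also contains `π h`.
  choose c hdvd hle hlt using exists_block.{u}
  have key := iterNatSum_regroup (ζ := ζ) (ζ' := ζ) (F := fun h ↦ {π h}) (c := c) α
    ?_ ?_ ?_ (fun h _ ↦ hdvd h) ?_ (fun h hh ↦ (hle h).trans_lt hh) ?_
  · simpa only [finNatSum_singleton] using key
  · intro δ
    simp only [Finset.mem_singleton]
    constructor
    · intro hδ
      obtain ⟨h, hh, rfl⟩ := hπ.surjOn hδ
      exact ⟨h, hh, rfl⟩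
    · rintro ⟨h, hh, rfl⟩
      exact hπ.mapsTo hh
  · intro h hh k hk hne
    simpa [Function.onFun] using fun e ↦ hne (hπ.injOn hh hk e)
  · intro h _ h' _ hc
    exact (hlt h).trans_le ((add_omega0_le_of_lt (hdvd h) (hdvd h') hc).trans (hle h'))
  · intro h hh δ hδ
    have hcomp : IsComponent ζ (Set.Ico (c h) (min (c h + omega0) ζ)) :=
      ⟨c h, (hle h).trans_lt hh, eq_zero_or_isSuccLimit_iff.2 (hdvd h), rfl⟩
    have hmem : π h ∈ Set.Ico (c h) (min (c h + omega0) ζ) := by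
      have := Set.mem_image_of_mem π
        (show h ∈ Set.Ico (c h) (min (c h + omega0) ζ) from ⟨hle h, lt_min (hlt h) hh⟩)
      rwa [hπC _ hcomp] at this
    rw [Finset.mem_singleton.1 hδ]
    exact ⟨hmem.1, hmem.2.trans_le (min_le_left _ _)⟩
  · intro h _
    exact (finite_Ico_of_lt_add_omega0 (hlt h)).subset fun k hk ↦ ⟨hk.2 ▸ hle k, hk.1⟩

end IterNatSum

theorem proposition5p5 (ζ : Ordinal.{u}) (α : Ordinal.{u} → Ordinal.{u}) :
    -- (1) invariance under permutations of `ζ` which fix each component setwise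
    (∀ π : Ordinal.{u} → Ordinal.{u},
      Set.BijOn π (Set.Iio ζ) (Set.Iio ζ) →
      (∀ C, IterNatSum.IsComponent ζ C → π '' C = C) →
      IterNatSum.iterNatSum α ζ = IterNatSum.iterNatSum (fun γ ↦ α (π γ)) ζ) ∧
    -- (2) the generalized associative-commutative law
    (∀ (ζ' : Ordinal.{u}) (F : Ordinal.{u} → Finset Ordinal.{u})
        (C : Ordinal.{u} → Set Ordinal.{u}),
      -- the finite sets `F h`, for `h < ζ'`, partition `ζ`
      (∀ δ, δ < ζ ↔ ∃ h < ζ', δ ∈ F h) →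
      (Set.Iio ζ').PairwiseDisjoint F →
      -- each `F h` is contained in a component `C h` of `ζ`
      (∀ h < ζ', IterNatSum.IsComponent ζ (C h)) →
      (∀ h < ζ', (F h : Set Ordinal.{u}) ⊆ C h) →
      -- the ordering of the `F h` respects the ordering of the components
      (∀ h < ζ', ∀ h' < ζ', IterNatSum.Precedes (C h) (C h') → h < h') →
      -- inside each component the `F h` are arranged in order type at most `ω`
      (∀ h < ζ', {k | k < h ∧ C k = C h}.Finite) →
      IterNatSum.iterNatSum α ζ =
        IterNatSum.iterNatSum (fun h ↦ IterNatSum.finNatSum (F h) α) ζ') := by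
  exact ⟨fun π hπ hπC ↦ IterNatSum.iterNatSum_perm α π hπ hπC,
    fun _ F C hF hdisj hC hFC hprec hfin ↦
      IterNatSum.iterNatSum_regroup_of_isComponent α F C hF hdisj hC hFC hprec hfin⟩
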